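/- Let $\mathbb{K}$ be an algebraically closed field of characteristic $0$, $\mathrm{U}(n)=\mathbb{K}[\tilde h_1,\dots,\tilde h_n]$, $\mathbb{K}(n)$ its field of fractions, $\tilde h_{ij}=\tilde h_i-\tilde h_j$, and let $\bar{\mathrm U}(n)\subset\mathbb{K}(n)$ be the localization of $\mathrm U(n)$ at all $\tilde h_{ij}+k$, $i\ne j$, $k\in\mathbb{Z}$. Let $\varepsilon_j$ be the $\mathbb{K}$-automorphism $\tilde h_i\mapsto\tilde h_i+\delta_{ij}$ of $\mathbb{K}(n)$, written $f\mapsto f[\varepsilon_j]$, with inverse $f\mapsto f[-\varepsilon_j]$, and put $\Delta_jf=f-f[-\varepsilon_j]$. Apply $\Delta_j$ coefficientwise to polynomials in an auxiliary variable $t$. Put $\chi_k=\prod_{s\ne k}\tilde h_{ks}$ and $e(t)=\prod_{i=1}^n(1+\tilde h_it)$. Let $\bar{\mathcal W}$ (respectively $\mathcal W$) be the space of all $\sigma=\sum_{k=1}^n\pi_k(\tilde h_k)/\chi_k\in\mathbb{K}(n)$ with $\pi_k\in\mathbb{K}(t)$ (respectively $\pi_k\in\mathbb{K}[t]$). Let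 $\sigma\in\mathbb{K}(n)$, $\sigma_j=\Delta_j\sigma$, and let $B$ be a $\mathbb{K}$-subalgebra of $\mathbb{K}(n)$ that contains $\bar{\mathrm U}(n)$ and $\sigma_1,\dots,\sigma_n$ and is stable under all $\pm\varepsilon_j$ (for example $B=\bar{\mathrm U}(n)$ if all $\sigma_j\in\bar{\mathrm U}(n)$, and always $B=\mathbb{K}(n)$). Let $\mathrm{Diff}_{\mathbf h,\sigma}(n)$ be the ring over $B$ generated by $x^i,\bar\partial_i$, $1\le i\le n$, with the defining relations $b\,x^j=x^j\,b[\varepsilon_j]$, $b\,\bar\partial_j=\bar\partial_j\,b[-\varepsilon_j]$ for $b\in B$; $x^ix^j=\frac{\tilde h_{ij}+1}{\tilde h_{ij}}x^jx^i$ and $\bar\partial_i\bar\partial_j=\frac{\tilde h_{ij}-1}{\tilde h_{ij}}\bar\partial_j\bar\partial_i$ for $i<j$; $x^i\bar\partial_j=\bar\partial_jx^i$ for $i<j$; $x^i\bar\partial_j=\frac{\tilde h_{ij}(\tilde h_{ij}-2)}{(\tilde h_{ij}-1)^2}\bar\partial_jx^i$ for $i>j$; and $x^i\bar\partial_i=\sum_{j}\frac{1}{1-\tilde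 h_{ij}}\bar\partial_jx^j-\sigma_i$. Let $\Gamma_i=\bar\partial_ix^i$. (i) Let $\sigma\in\bar{\mathcal W}$, let $B$ be as above, and let $\rho(t)\in B[t]$ be of degree at most $n-1$. Define $c_1,\dots,c_n\in\mathrm{Diff}_{\mathbf h,\sigma}(n)$ by $$c(t)=\sum_{i=1}^n\frac{e(t)}{1+\tilde h_it}\,\Gamma_i-\rho(t)=\sum_{k=1}^nc_kt^{k-1}.$$ Then $c_1,\dots,c_n$ are all central in $\mathrm{Diff}_{\mathbf h,\sigma}(n)$ if and only if $$\Delta_j\rho(t)=\frac{e(t)}{1+\tilde h_jt}\,\sigma_j\qquad\text{for all }j=1,\dots,n.\qquad(*)$$ (ii) Let $\sigma\in\mathcal W$. Then the system $(*)$ has a solution $\rho(t)\in\bar{\mathrm U}(n)[t]$ of degree at most $n-1$, and any two solutions in $\mathbb{K}(n)[t]$ differ by an element of $\mathbb{K}[t]$. Moreover, whenever $\sigma=\sum_{k=1}^n\pi_k(\tilde h_k)/\chi_k$ with $\pi_k\in\mathbb{K}[t]$, the solutions of $(*)$ in $\mathbb{K}(n)[t]$ of degree at most $n-1$ are exactly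 the polynomials $$\rho(t)=\sum_{k=1}^n\frac{e(t)}{1+\tilde h_kt}\,\frac{\pi_k(\tilde h_k)}{\chi_k}+p(t),\qquad p(t)\in\mathbb{K}[t],\ \deg p\le n-1.$$ -/

import Mathlib

open Polynomial

noncomputable section

namespace HDiff

variable (K : Type*) [Field K] (n : ℕ)

/-- The field `K(n)` of rational functions over `K` in the commuting variables `h̃_1, …, h̃_n`,
that is, the field of fractions of the polynomial ring `U(n)`. -/
abbrev RatH : Type _ := FractionRing (MvPolynomial (Fin n) K)

variable {n}

/-- The generator `h̃_i`. -/
def h (i : Fin n) : RatH K n := algebraMap (MvPolynomial (Fin n) K) (RatH K n) (MvPolynomial.X i)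

/-- `h̃_{ij} = h̃_i - h̃_j`. -/
def hd (i j : Fin n) : RatH K n := h K i - h K j

/-- The elementary translation `h̃_i ↦ h̃_i + δ_{ij}` of the polynomial ring `U(n)`. -/
def shiftPoly (j : Fin n) : MvPolynomial (Fin n) K ≃ₐ[K] MvPolynomial (Fin n) K :=
  AlgEquiv.ofAlgHom
    (MvPolynomial.aeval fun i => MvPolynomial.X i + (if i = j then 1 else 0))
    (MvPolynomial.aeval fun i => MvPolynomial.X i - (if i = j then 1 else 0))
    (by
      ext i : 1
      by_cases hij : i = j <;> simp [hij])
    (by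
      ext i : 1
      by_cases hij : i = j <;> simp [hij])

/-- The elementary translation `ε_j` of the field `K(n)`; `f[ε_j]` is `shift K j f` and `f[-ε_j]`
is `(shift K j).symm f`. -/
def shift (j : Fin n) : RatH K n ≃ₐ[K] RatH K n :=
  IsFractionRing.fieldEquivOfAlgEquiv K (RatH K n) (RatH K n) (shiftPoly K j)

/-- The finite difference operator `Δ_j f = f - f[-ε_j]`. -/
def Δ (j : Fin n) (f : RatH K n) : RatH K n := f - (shift K j).symm f

/-- `Δ_j` applied coefficientwise to a polynomial in `t` with coefficients in `K(n)`. -/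
def Δt (j : Fin n) (ρ : (RatH K n)[X]) : (RatH K n)[X] :=
  ρ - ρ.map ((shift K j).symm : RatH K n →+* RatH K n)

/-- `χ_k = ∏_{s ≠ k} h̃_{ks}`. -/
def χ (k : Fin n) : RatH K n := ∏ s ∈ Finset.univ.erase k, hd K k s

/-- `e(t) = ∏_i (1 + h̃_i t)`. -/
def e : (RatH K n)[X] := ∏ i : Fin n, (1 + C (h K i) * X)

/-- The polynomial `e(t) / (1 + h̃_i t)`. -/
def eDiv (i : Fin n) : (RatH K n)[X] := ∏ l ∈ Finset.univ.erase i, (1 + C (h K l) * X)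

theorem eDiv_mul (i : Fin n) : (1 + C (h K i) * X) * eDiv K i = e K :=
  Finset.mul_prod_erase Finset.univ (fun l => 1 + C (h K l) * X) (Finset.mem_univ i)

theorem shift_h (j i : Fin n) : shift K j (h K i) = h K i + (if i = j then 1 else 0) := by
  unfold shift h
  rw [IsFractionRing.fieldEquivOfAlgEquiv_algebraMap]
  by_cases hij : i = j <;> simp [shiftPoly, hij]

theorem shift_symm_h (j i : Fin n) :
    (shift K j).symm (h K i) = h K i - (if i = j then 1 else 0) := by
  rw [AlgEquiv.symm_apply_eq, map_sub, shift_h]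
  by_cases hij : i = j <;> simp [hij]

theorem aeval_h_injective (j : Fin n) : Function.Injective (aeval (R := K) (h K j)) := by
  have h1 : Transcendental K (h K j) := by
    unfold h
    exact (transcendental_algebraMap_iff
      (IsFractionRing.injective (MvPolynomial (Fin n) K) (RatH K n))).2
      (MvPolynomial.transcendental_X (R := K) j)
  exact transcendental_iff_injective.1 h1

/-- Substitution `π(t) ↦ π(h̃_j)` of `h̃_j` into univariate rational functions. -/
def ratEval (j : Fin n) : RatFunc K →ₐ[K] RatH K n :=
  RatFunc.liftAlgHom (aeval (h K j))
    (nonZeroDivisors_le_comap_nonZeroDivisors_of_injective _ (aeval_h_injective K j))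

variable (n)

/-- The space `𝒲 = ∑_j 𝒲_j`, where `𝒲_j` consists of the `π(h̃_j) / χ_j` with `π ∈ K[t]`. -/
def W : Submodule K (RatH K n) :=
  ⨆ j : Fin n, LinearMap.range
    (LinearMap.mulLeft K (χ K j)⁻¹ ∘ₗ (aeval (R := K) (h K j)).toLinearMap)

/-- The space `𝒲̄ = ∑_j 𝒲̄_j`, where `𝒲̄_j` consists of the `π(h̃_j) / χ_j` with `π ∈ K(t)`. -/
def Wbar : Submodule K (RatH K n) :=
  ⨆ j : Fin n, LinearMap.range (LinearMap.mulLeft K (χ K j)⁻¹ ∘ₗ (ratEval K j).toLinearMap)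

/-- `Ū(n)`: the localization of `U(n)` at the elements `h̃_{ij} + k`, `i ≠ j`, `k ∈ ℤ`, realized
inside `K(n)`. -/
def Ubar : Subalgebra K (RatH K n) :=
  Algebra.adjoin K
    (Set.range (h K) ∪ {f | ∃ (i j : Fin n) (k : ℤ), i ≠ j ∧ f = (hd K i j + (k : RatH K n))⁻¹})

/-- A ring of coefficients for the `h`-deformed differential operators: a `K`-subalgebra of `K(n)`
that contains `Ū(n)` and is stable under all translations `±ε_j`. -/
structure CoeffRing where
  carrier : Subalgebra K (RatH K n)
  ubar_le : Ubar K n ≤ carrier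
  shift_mem : ∀ (j : Fin n) (f : RatH K n), f ∈ carrier → shift K j f ∈ carrier
  shift_symm_mem : ∀ (j : Fin n) (f : RatH K n), f ∈ carrier → (shift K j).symm f ∈ carrier

variable {K n}

theorem h_mem_Ubar (i : Fin n) : h K i ∈ Ubar K n :=
  Algebra.subset_adjoin (Or.inl ⟨i, rfl⟩)

theorem hd_mem_Ubar (i j : Fin n) : hd K i j ∈ Ubar K n :=
  sub_mem (h_mem_Ubar i) (h_mem_Ubar j)

theorem hd_self (i : Fin n) : hd K i i = 0 := sub_self _

theorem inv_mem_Ubar {i j : Fin n} (hij : i ≠ j) (k : ℤ) :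
    (hd K i j + (k : RatH K n))⁻¹ ∈ Ubar K n :=
  Algebra.subset_adjoin (Or.inr ⟨i, j, k, hij, rfl⟩)

theorem hd_inv_mem_Ubar {i j : Fin n} (hij : i ≠ j) : (hd K i j)⁻¹ ∈ Ubar K n := by
  simpa using inv_mem_Ubar (K := K) hij 0

theorem hd_sub_one_inv_mem_Ubar {i j : Fin n} (hij : i ≠ j) : (hd K i j - 1)⁻¹ ∈ Ubar K n := by
  have h1 := inv_mem_Ubar (K := K) hij (-1)
  rwa [Int.cast_neg, Int.cast_one, ← sub_eq_add_neg] at h1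

/-- `Ū(n)` is stable under the translations `ε_j`. -/
theorem shift_mem_Ubar (j : Fin n) (f : RatH K n) (hf : f ∈ Ubar K n) :
    shift K j f ∈ Ubar K n := by
  have h1 : Ubar K n ≤ (Ubar K n).comap (shift K j).toAlgHom := by
    refine Algebra.adjoin_le ?_
    rintro _ (⟨i, rfl⟩ | ⟨a, b, k, hab, rfl⟩)
    · change shift K j (h K i) ∈ Ubar K n
      rw [shift_h]
      refine add_mem (h_mem_Ubar i) ?_
      split_ifs
      · exact one_mem _
      · exact zero_mem _
    · change shift K j (hd K a b + (k : RatH K n))⁻¹ ∈ Ubar K n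
      have h2 : shift K j (hd K a b + (k : RatH K n))⁻¹ = (hd K a b + ((k +
          ((if a = j then 1 else 0) - (if b = j then 1 else 0)) : ℤ) : RatH K n))⁻¹ := by
        simp only [hd, map_inv₀, map_add, map_sub, shift_h, map_intCast]
        push_cast
        congr 1
        ring
      rw [h2]
      exact inv_mem_Ubar hab _
  exact h1 hf

/-- `Ū(n)` is stable under the translations `-ε_j`. -/
theorem shift_symm_mem_Ubar (j : Fin n) (f : RatH K n) (hf : f ∈ Ubar K n) :
    (shift K j).symm f ∈ Ubar K n := by
  have h1 : Ubar K n ≤ (Ubar K n).comap (shift K j).symm.toAlgHom := by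
    refine Algebra.adjoin_le ?_
    rintro _ (⟨i, rfl⟩ | ⟨a, b, k, hab, rfl⟩)
    · change (shift K j).symm (h K i) ∈ Ubar K n
      rw [shift_symm_h]
      refine sub_mem (h_mem_Ubar i) ?_
      split_ifs
      · exact one_mem _
      · exact zero_mem _
    · change (shift K j).symm (hd K a b + (k : RatH K n))⁻¹ ∈ Ubar K n
      have h2 : (shift K j).symm (hd K a b + (k : RatH K n))⁻¹ = (hd K a b + ((k -
          ((if a = j then 1 else 0) - (if b = j then 1 else 0)) : ℤ) : RatH K n))⁻¹ := by
        simp only [hd, map_inv₀, map_add, map_sub, shift_symm_h, map_intCast]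
        push_cast
        congr 1
        ring
      rw [h2]
      exact inv_mem_Ubar hab _
  exact h1 hf

namespace CoeffRing

variable (K n) in
/-- `Ū(n)` itself as a ring of coefficients: the smallest choice. -/
def ubar : CoeffRing K n := ⟨Ubar K n, le_rfl, shift_mem_Ubar, shift_symm_mem_Ubar⟩

variable (K n) in
/-- The whole field `K(n)` as a ring of coefficients: the largest choice. -/
def full : CoeffRing K n := ⟨⊤, le_top, fun _ _ _ => trivial, fun _ _ _ => trivial⟩

variable (B : CoeffRing K n)

/-- An element of `Ū(n)` as an element of the ring of coefficients. -/
def ofUbar (f : RatH K n) (hf : f ∈ Ubar K n) : B.carrier := ⟨f, B.ubar_le hf⟩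

/-- `b[ε_j]` in the ring of coefficients. -/
def sh (j : Fin n) (b : B.carrier) : B.carrier := ⟨shift K j b, B.shift_mem j b b.2⟩

/-- `b[-ε_j]` in the ring of coefficients. -/
def shInv (j : Fin n) (b : B.carrier) : B.carrier :=
  ⟨(shift K j).symm b, B.shift_symm_mem j b b.2⟩

/-- `(h̃_{ij} + 1) / h̃_{ij}`, for `i ≠ j`. -/
def cxx {i j : Fin n} (hij : i ≠ j) : B.carrier :=
  B.ofUbar ((hd K i j + 1) / hd K i j) (by
    rw [div_eq_mul_inv]
    exact mul_mem (add_mem (hd_mem_Ubar i j) (one_mem _)) (hd_inv_mem_Ubar hij))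

/-- `(h̃_{ij} - 1) / h̃_{ij}`, for `i ≠ j`. -/
def cdd {i j : Fin n} (hij : i ≠ j) : B.carrier :=
  B.ofUbar ((hd K i j - 1) / hd K i j) (by
    rw [div_eq_mul_inv]
    exact mul_mem (sub_mem (hd_mem_Ubar i j) (one_mem _)) (hd_inv_mem_Ubar hij))

/-- `h̃_{ij} (h̃_{ij} - 2) / (h̃_{ij} - 1)²`, for `i ≠ j`. -/
def cxd {i j : Fin n} (hij : i ≠ j) : B.carrier :=
  B.ofUbar (hd K i j * (hd K i j - 2) / (hd K i j - 1) ^ 2) (by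
    rw [div_eq_mul_inv, ← inv_pow]
    exact mul_mem (mul_mem (hd_mem_Ubar i j) (sub_mem (hd_mem_Ubar i j) (ofNat_mem _ 2)))
      (pow_mem (hd_sub_one_inv_mem_Ubar hij) 2))

/-- `1 / (1 - h̃_{ij})`, for all `i, j` (it is `1` for `i = j`). -/
def cdiag (i j : Fin n) : B.carrier :=
  B.ofUbar (1 / (1 - hd K i j)) (by
    by_cases hij : i = j
    · subst hij
      rw [hd_self, sub_zero, div_one]
      exact one_mem _
    · rw [← neg_sub (hd K i j) 1, one_div, inv_neg]
      exact neg_mem (hd_sub_one_inv_mem_Ubar hij))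

/-- `e(t) / (1 + h̃_i t)` as a polynomial over the ring of coefficients. -/
def eDivB (i : Fin n) : B.carrier[X] :=
  ∏ l ∈ Finset.univ.erase i, (1 + C (B.ofUbar (h K l) (h_mem_Ubar l)) * X)

theorem eDivB_map (i : Fin n) :
    (B.eDivB i).map (algebraMap B.carrier (RatH K n)) = eDiv K i := by
  simp only [eDivB, eDiv, Polynomial.map_prod, Polynomial.map_add, Polynomial.map_one,
    Polynomial.map_mul, Polynomial.map_C, Polynomial.map_X]
  rfl

/-- Generators of the ring of `h`-deformed differential operators: the coefficients, the
coordinates `x^i` and the derivatives `∂̄_i`. -/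
inductive Gen : Type _
  | coeff (b : B.carrier) : Gen
  | x (i : Fin n) : Gen
  | d (i : Fin n) : Gen

/-- The free generators `b ∈ B`, `x^i` and `∂̄_i` as elements of the free algebra. -/
def fb (b : B.carrier) : FreeAlgebra K B.Gen := FreeAlgebra.ι K (Gen.coeff b)

def fx (i : Fin n) : FreeAlgebra K B.Gen := FreeAlgebra.ι K (Gen.x i)

def fd (i : Fin n) : FreeAlgebra K B.Gen := FreeAlgebra.ι K (Gen.d i)

/-- The defining relations. The first three make `B` map homomorphically into the quotient. -/
inductive Rel (s : Fin n → B.carrier) : FreeAlgebra K B.Gen → FreeAlgebra K B.Gen → Prop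
  | coeff_add (a b : B.carrier) : Rel s (B.fb (a + b)) (B.fb a + B.fb b)
  | coeff_mul (a b : B.carrier) : Rel s (B.fb (a * b)) (B.fb a * B.fb b)
  | coeff_scalar (r : K) : Rel s (B.fb (algebraMap K B.carrier r)) (algebraMap K _ r)
  | weight_x (j : Fin n) (b : B.carrier) : Rel s (B.fb b * B.fx j) (B.fx j * B.fb (B.sh j b))
  | weight_d (j : Fin n) (b : B.carrier) : Rel s (B.fb b * B.fd j) (B.fd j * B.fb (B.shInv j b))
  | xx (i j : Fin n) (hij : i < j) :
      Rel s (B.fx i * B.fx j) (B.fb (B.cxx hij.ne) * B.fx j * B.fx i)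
  | dd (i j : Fin n) (hij : i < j) :
      Rel s (B.fd i * B.fd j) (B.fb (B.cdd hij.ne) * B.fd j * B.fd i)
  | xd_lt (i j : Fin n) (hij : i < j) : Rel s (B.fx i * B.fd j) (B.fd j * B.fx i)
  | xd_gt (i j : Fin n) (hij : j < i) :
      Rel s (B.fx i * B.fd j) (B.fb (B.cxd hij.ne') * B.fd j * B.fx i)
  | xd_diag (i : Fin n) :
      Rel s (B.fx i * B.fd i) (∑ j : Fin n, B.fb (B.cdiag i j) * B.fd j * B.fx j - B.fb (s i))

/-- The ring `Diff_h(s_1, …, s_n)` over the ring of coefficients `B`. -/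
abbrev Diff (s : Fin n → B.carrier) : Type _ := RingQuot (B.Rel s)

variable (s : Fin n → B.carrier)

/-- The structure homomorphism from the ring of coefficients. -/
def coeffHom : B.carrier →+* B.Diff s where
  toFun b := RingQuot.mkAlgHom K (B.Rel s) (B.fb b)
  map_one' := by
    have h1 := RingQuot.mkAlgHom_rel K (Rel.coeff_scalar (B := B) (s := s) 1)
    rwa [map_one, map_one, map_one] at h1
  map_mul' a b := by
    rw [RingQuot.mkAlgHom_rel K (Rel.coeff_mul (s := s) a b), map_mul]
  map_zero' := by
    have h1 := RingQuot.mkAlgHom_rel K (Rel.coeff_scalar (B := B) (s := s) 0)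
    rwa [map_zero, map_zero, map_zero] at h1
  map_add' a b := by
    rw [RingQuot.mkAlgHom_rel K (Rel.coeff_add (s := s) a b), map_add]

/-- The generator `x^i` of `Diff_h(s_1, …, s_n)`. -/
def x (i : Fin n) : B.Diff s := RingQuot.mkAlgHom K (B.Rel s) (B.fx i)

/-- The generator `∂̄_i` of `Diff_h(s_1, …, s_n)`. -/
def d (i : Fin n) : B.Diff s := RingQuot.mkAlgHom K (B.Rel s) (B.fd i)

/-- `Γ_i = ∂̄_i x^i`. -/
def Γ (i : Fin n) : B.Diff s := B.d s i * B.x s i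

/-- `c(t) = ∑_i e(t) / (1 + h̃_i t) Γ_i - ρ(t)`, a polynomial in the central indeterminate `t`. -/
def c (ρ : B.carrier[X]) : (B.Diff s)[X] :=
  ∑ i : Fin n, (B.eDivB i).map (B.coeffHom s) * C (B.Γ s i) - ρ.map (B.coeffHom s)

end CoeffRing

variable (K n) in
/-- The system of finite-difference equations `Δ_j ρ(t) = e(t) / (1 + h̃_j t) · Δ_j σ` for all
`j`. -/
def Solves (σ : RatH K n) (ρ : (RatH K n)[X]) : Prop :=
  ∀ j : Fin n, Δt K j ρ = eDiv K j * C (Δ K j σ)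

end HDiff

end

/-! ### Translations of the field `K(n)` and non-vanishing of `h̃_{ij} + k`. -/

noncomputable section

namespace HDiff

variable {K : Type*} [Field K] {n : ℕ}

/-! Write `G_k = π_k(h̃_k) / χ_k`. For `j ≠ k` the variable `h̃_j` enters `G_k` through a single
factor of `χ_k`, so `G_k[-ε_j] = G_k h̃_{kj} / (h̃_{kj} + 1)`. This rule (`IsWeightFamily`) is all
that is ever used about `G`. Together with the exchange identity `eDiv_shift_symm` it shows that `∑
e(t)/(1 + h̃_k t) G_k` solves the system for `σ = ∑ G_k` (`IsWeightFamily.solves`). Two solutions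
differ by a polynomial whose coefficients are invariant under all translations, and in
characteristic zero such rational functions are constants (`exists_eq_algebraMap_of_shift_fixed`).
This gives (ii).

For (i), if `ρ` solves the system, the defining relations give the commutation of `Γ_i` with `x^j`
and `∂̄_j` for `i ≠ j` (`x_mul_Γ`, `Γ_mul_d`), with the same factor `h̃_{ij} / (h̃_{ij} + 1)`. By
the exchange identity, the error terms for `i ≠ j` cancel against the sum in the relation for `x^j
∂̄_j`; what remains is `e(t)/(1 + h̃_j t) σ_j`, which `Δ_j ρ` absorbs (`x_mul_c_coeff`,
`c_coeff_mul_d`).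

Conversely, no basis theorem for the ring is needed: a decomposition `σ = ∑ G_k` yields a
representation `rep` by difference operators on `K(n)` in which `Γ_i` acts as multiplication by
`G_i`. There `c(t)` acts as multiplication by `∑ e(t)/(1 + h̃_i t) G_i - ρ(t)`, and commuting with
`x^j` forces this polynomial to be invariant under `ε_j` (`solves_of_central`). Since the sum
already solves the system, so does `ρ`. -/

theorem shift_hd (j a b : Fin n) :
    shift K j (hd K a b) = hd K a b + ((if a = j then 1 else 0) - (if b = j then 1 else 0)) := by
  simp only [hd, map_sub, shift_h]
  ring

theorem shift_symm_hd (j a b : Fin n) :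
    (shift K j).symm (hd K a b) =
      hd K a b - ((if a = j then 1 else 0) - (if b = j then 1 else 0)) := by
  simp only [hd, map_sub, shift_symm_h]
  ring

theorem hd_swap (i j : Fin n) : hd K i j = -hd K j i := (neg_sub _ _).symm

theorem hd_add_intCast_ne_zero {i j : Fin n} (hij : i ≠ j) (k : ℤ) :
    hd K i j + (k : RatH K n) ≠ 0 := by
  intro h0
  have h1 : algebraMap (MvPolynomial (Fin n) K) (RatH K n)
      (MvPolynomial.X i - MvPolynomial.X j + (k : MvPolynomial (Fin n) K)) = 0 := by
    rw [map_add, map_sub, map_intCast]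
    exact h0
  rw [map_eq_zero_iff _ (IsFractionRing.injective (MvPolynomial (Fin n) K) (RatH K n))] at h1
  -- At the point with `i`-th coordinate `1 - k` and all others `0` the polynomial takes the value
  -- `1`, whatever the characteristic.
  have h2 := congrArg (MvPolynomial.eval fun l => if l = i then 1 - (k : K) else 0) h1
  simp [hij.symm] at h2

theorem hd_ne_zero {i j : Fin n} (hij : i ≠ j) : hd K i j ≠ 0 := by
  simpa using hd_add_intCast_ne_zero (K := K) hij 0

theorem hd_add_one_ne_zero {i j : Fin n} (hij : i ≠ j) : hd K i j + 1 ≠ 0 := by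
  simpa using hd_add_intCast_ne_zero (K := K) hij 1

theorem hd_sub_one_ne_zero {i j : Fin n} (hij : i ≠ j) : hd K i j - 1 ≠ 0 := by
  simpa [sub_eq_add_neg] using hd_add_intCast_ne_zero (K := K) hij (-1)

theorem hd_sub_two_ne_zero {i j : Fin n} (hij : i ≠ j) : hd K i j - 2 ≠ 0 := by
  simpa [sub_eq_add_neg] using hd_add_intCast_ne_zero (K := K) hij (-2)

theorem shift_algebraMap (j : Fin n) (p : MvPolynomial (Fin n) K) :
    shift K j (algebraMap _ (RatH K n) p) = algebraMap _ (RatH K n) (shiftPoly K j p) := by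
  unfold shift
  rw [IsFractionRing.fieldEquivOfAlgEquiv_algebraMap]

theorem shiftPoly_X (j i : Fin n) :
    shiftPoly K j (MvPolynomial.X i) = MvPolynomial.X i + (if i = j then 1 else 0) := by
  simp [shiftPoly]

theorem shiftPoly_comm (i j : Fin n) (p : MvPolynomial (Fin n) K) :
    shiftPoly K i (shiftPoly K j p) = shiftPoly K j (shiftPoly K i p) := by
  have h1 : (shiftPoly K i).toAlgHom.comp (shiftPoly K j).toAlgHom =
      (shiftPoly K j).toAlgHom.comp (shiftPoly K i).toAlgHom := by
    ext l : 1
    change shiftPoly K i (shiftPoly K j (MvPolynomial.X l)) =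
      shiftPoly K j (shiftPoly K i (MvPolynomial.X l))
    have h1 : ∀ (k : Fin n) (P : Prop) [Decidable P], shiftPoly K k (if P then 1 else 0) =
        (if P then 1 else 0) := fun k P _ => by split_ifs <;> simp
    simp only [shiftPoly_X, map_add, h1]
    ring
  exact DFunLike.congr_fun h1 p

theorem shift_comm (i j : Fin n) (f : RatH K n) :
    shift K i (shift K j f) = shift K j (shift K i f) := by
  obtain ⟨p, q, -, rfl⟩ := IsFractionRing.div_surjective (A := MvPolynomial (Fin n) K) f
  simp only [map_div₀, shift_algebraMap, shiftPoly_comm i j]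

theorem shift_symm_shift_comm (i j : Fin n) (f : RatH K n) :
    (shift K i).symm (shift K j f) = shift K j ((shift K i).symm f) := by
  rw [AlgEquiv.symm_apply_eq, shift_comm, AlgEquiv.apply_symm_apply]

theorem shift_symm_comm (i j : Fin n) (f : RatH K n) :
    (shift K i).symm ((shift K j).symm f) = (shift K j).symm ((shift K i).symm f) := by
  rw [AlgEquiv.symm_apply_eq, ← shift_symm_shift_comm, AlgEquiv.apply_symm_apply]

theorem ratEval_algebraMap (j : Fin n) (p : K[X]) :
    ratEval K j (algebraMap _ _ p) = aeval (h K j) p := by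
  unfold ratEval
  rw [RatFunc.liftAlgHom_apply]
  simp

theorem aeval_h_shift_symm {j k : Fin n} (hkj : k ≠ j) (p : K[X]) :
    (shift K j).symm (aeval (h K k) p) = aeval (h K k) p := by
  have h1 := Polynomial.aeval_algHom_apply (shift K j).symm.toAlgHom (h K k) p
  have h2 : (shift K j).symm.toAlgHom (h K k) = h K k := by
    change (shift K j).symm (h K k) = h K k
    simp [shift_symm_h, hkj]
  rw [h2] at h1
  exact h1.symm

theorem ratEval_shift_symm {j k : Fin n} (hkj : k ≠ j) (r : RatFunc K) :
    (shift K j).symm (ratEval K k r) = ratEval K k r := by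
  rw [← RatFunc.num_div_denom r]
  simp only [map_div₀, ratEval_algebraMap, aeval_h_shift_symm hkj]

/-- A ring homomorphism that moves only one factor of a product. -/
theorem map_prod_mul_of_fixed {ι R : Type*} [DecidableEq ι] [CommSemiring R] (T : R →+* R)
    (s : Finset ι) (f : ι → R) {j : ι} (hj : j ∈ s) (hf : ∀ l ∈ s, l ≠ j → T (f l) = f l) :
    T (∏ l ∈ s, f l) * f j = (∏ l ∈ s, f l) * T (f j) := by
  have h1 : ∏ l ∈ s.erase j, T (f l) = ∏ l ∈ s.erase j, f l :=
    Finset.prod_congr rfl fun l hl => hf l (Finset.mem_of_mem_erase hl) (Finset.ne_of_mem_erase hl)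
  rw [map_prod, ← Finset.mul_prod_erase s _ hj, ← Finset.mul_prod_erase s f hj, h1]
  ring

theorem χ_ne_zero (k : Fin n) : χ K k ≠ 0 :=
  Finset.prod_ne_zero_iff.2 fun _ hs => hd_ne_zero (Finset.ne_of_mem_erase hs).symm

/-- Among the factors of `χ_k` only `h̃_{kj}` involves `h̃_j`, and it becomes `h̃_{kj} + 1`. -/
theorem χ_shift_symm {j k : Fin n} (hkj : k ≠ j) :
    (shift K j).symm (χ K k) * hd K k j = χ K k * (hd K k j + 1) := by
  have h1 := map_prod_mul_of_fixed ((shift K j).symm : RatH K n →+* RatH K n)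
    (Finset.univ.erase k) (hd K k) (Finset.mem_erase.2 ⟨hkj.symm, Finset.mem_univ j⟩)
    (fun l _ hl => by
      change (shift K j).symm (hd K k l) = hd K k l
      simp [shift_symm_hd, hkj, hl])
  have h2 : ((shift K j).symm : RatH K n →+* RatH K n) (hd K k j) = hd K k j + 1 := by
    change (shift K j).symm (hd K k j) = hd K k j + 1
    simp [shift_symm_hd, hkj]
  rw [h2] at h1
  exact h1

/-! ### Weight families: the transformation rule of `1 / χ_k`. -/

variable (K) in
/-- Families `G` with `G_k` in `𝒲̄_k` transform under the translations `-ε_j`, `j ≠ k`, as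
`1 / χ_k` does. -/
def IsWeightFamily (G : Fin n → RatH K n) : Prop :=
  ∀ k j : Fin n, k ≠ j → (shift K j).symm (G k) = G k * hd K k j / (hd K k j + 1)

theorem isWeightFamily_div_χ (a : Fin n → RatH K n)
    (ha : ∀ k j, k ≠ j → (shift K j).symm (a k) = a k) :
    IsWeightFamily K fun k => a k / χ K k := by
  intro k j hkj
  have h1 := χ_shift_symm (K := K) hkj
  have h2 := χ_ne_zero (K := K) k
  have h3 := hd_ne_zero (K := K) hkj
  have h4 := hd_add_one_ne_zero (K := K) hkj
  have h5 : (shift K j).symm (χ K k) = χ K k * (hd K k j + 1) / hd K k j := by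
    rw [← h1]; field_simp
  rw [map_div₀, ha k j hkj, h5]
  field_simp

theorem IsWeightFamily.shift {G : Fin n → RatH K n} (hG : IsWeightFamily K G) {k j : Fin n}
    (hkj : k ≠ j) : shift K j (G k) = G k * hd K k j / (hd K k j - 1) := by
  have h1 := congrArg (HDiff.shift K j) (hG k j hkj)
  have h3 := hd_ne_zero (K := K) hkj
  have h4 := hd_sub_one_ne_zero (K := K) hkj
  rw [AlgEquiv.apply_symm_apply, map_div₀, map_mul, map_add, map_one, shift_hd] at h1
  simp only [hkj, if_true, if_false, zero_sub, ← sub_eq_add_neg, sub_add_cancel] at h1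
  rw [eq_div_iff h4]
  -- `G k` also occurs under `shift` on the left, so only the right-hand side may be rewritten.
  conv_rhs => rw [h1]
  field_simp

theorem IsWeightFamily.Δ_eq {G : Fin n → RatH K n} (hG : IsWeightFamily K G) {k j : Fin n}
    (hkj : k ≠ j) : Δ K j (G k) = G k / (hd K k j + 1) := by
  have h4 := hd_add_one_ne_zero (K := K) hkj
  rw [Δ, hG k j hkj]
  field_simp
  ring

/-! ### The polynomials `e(t) / (1 + h̃_i t)` and the particular solution. -/

theorem eDiv_shift_symm_self (j : Fin n) :
    (eDiv K j).map ((shift K j).symm : RatH K n →+* RatH K n) = eDiv K j := by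
  unfold eDiv
  rw [Polynomial.map_prod]
  refine Finset.prod_congr rfl fun l hl => ?_
  have h1 : ((shift K j).symm : RatH K n →+* RatH K n) (h K l) = h K l := by
    change (shift K j).symm (h K l) = h K l
    simp [shift_symm_h, Finset.ne_of_mem_erase hl]
  simp [h1]

/-- The basic exchange identity between the polynomials `e(t) / (1 + h̃_i t)`. -/
theorem eDiv_shift_symm {i j : Fin n} (hij : i ≠ j) :
    (eDiv K i).map ((shift K j).symm : RatH K n →+* RatH K n) *
        C (hd K i j / (hd K i j + 1)) + eDiv K j * C (1 / (hd K i j + 1)) = eDiv K i := by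
  have h4 := hd_add_one_ne_zero (K := K) hij
  -- `P` collects the factors common to both polynomials; it does not involve `h̃_j`, so the
  -- identity reduces to one between linear polynomials.
  obtain ⟨P, hP⟩ : ∃ P, P = ∏ l ∈ (Finset.univ.erase i).erase j, (1 + C (h K l) * X) := ⟨_, rfl⟩
  have hi : eDiv K i = (1 + C (h K j) * X) * P := by
    rw [hP]
    exact (Finset.mul_prod_erase _ (fun l => 1 + C (h K l) * X)
      (Finset.mem_erase.2 ⟨hij.symm, Finset.mem_univ j⟩)).symm
  have hj : eDiv K j = (1 + C (h K i) * X) * P := by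
    rw [hP, Finset.erase_right_comm]
    exact (Finset.mul_prod_erase _ (fun l => 1 + C (h K l) * X)
      (Finset.mem_erase.2 ⟨hij, Finset.mem_univ i⟩)).symm
  have hPs : P.map ((shift K j).symm : RatH K n →+* RatH K n) = P := by
    rw [hP, Polynomial.map_prod]
    refine Finset.prod_congr rfl fun l hl => ?_
    have h1 : ((shift K j).symm : RatH K n →+* RatH K n) (h K l) = h K l := by
      change (shift K j).symm (h K l) = h K l
      simp [shift_symm_h, Finset.ne_of_mem_erase hl]
    simp [h1]
  have hjs : ((shift K j).symm : RatH K n →+* RatH K n) (h K j) = h K j - 1 := by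
    change (shift K j).symm (h K j) = h K j - 1
    simp [shift_symm_h]
  have hu : hd K i j / (hd K i j + 1) = 1 - 1 / (hd K i j + 1) := by
    field_simp
    ring
  have hw : C (hd K i j + 1) * C (1 / (hd K i j + 1)) = 1 := by
    rw [← C_mul, mul_one_div_cancel h4, C_1]
  have hw' : (C (h K i) - C (h K j) + 1) * C (1 / (hd K i j + 1)) = 1 := by
    rw [← C_sub, ← C_1, ← C_add]
    exact hw
  rw [hi, hj, Polynomial.map_mul, hPs, hu]
  simp only [Polynomial.map_add, Polynomial.map_mul, Polynomial.map_one, Polynomial.map_C,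
    Polynomial.map_X, hjs, C_sub, C_1]
  -- With `w = 1 / (h̃_{ij} + 1)`, the two sides differ by `P t ((h̃_{ij} + 1) w - 1)`.
  linear_combination (P * X) * hw'

theorem Δt_mul_C (j : Fin n) (p : (RatH K n)[X]) (f : RatH K n) :
    Δt K j (p * C f) = p * C f -
      p.map ((shift K j).symm : RatH K n →+* RatH K n) * C ((shift K j).symm f) := by
  simp [Δt]

theorem Δt_add (j : Fin n) (p q : (RatH K n)[X]) : Δt K j (p + q) = Δt K j p + Δt K j q := by
  simp only [Δt, Polynomial.map_add]
  ring

theorem Δt_sub (j : Fin n) (p q : (RatH K n)[X]) : Δt K j (p - q) = Δt K j p - Δt K j q := by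
  simp only [Δt, Polynomial.map_sub]
  ring

theorem Δt_sum {ι : Type*} (j : Fin n) (s : Finset ι) (p : ι → (RatH K n)[X]) :
    Δt K j (∑ i ∈ s, p i) = ∑ i ∈ s, Δt K j (p i) := by
  simp only [Δt, Polynomial.map_sum, Finset.sum_sub_distrib]

theorem Δt_coeff (j : Fin n) (p : (RatH K n)[X]) (m : ℕ) :
    (Δt K j p).coeff m = Δ K j (p.coeff m) := by
  simp [Δt, Δ]

theorem Δt_map_algebraMap (j : Fin n) (p : K[X]) :
    Δt K j (p.map (algebraMap K (RatH K n))) = 0 := by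
  ext m
  simp [Δt_coeff, Δ]

theorem Δ_sum (j : Fin n) (G : Fin n → RatH K n) : Δ K j (∑ k, G k) = ∑ k, Δ K j (G k) := by
  simp only [Δ, map_sum, Finset.sum_sub_distrib]

/-- The equation holds summand by summand. For `k = j` the polynomial `e(t)/(1 + h̃_j t)` is fixed
by the translation; for `k ≠ j` the claim is the exchange identity multiplied by `G_k`, since `Δ_j
G_k = G_k / (h̃_{kj} + 1)`. -/
theorem IsWeightFamily.solves {G : Fin n → RatH K n} (hG : IsWeightFamily K G) :
    Solves K n (∑ k, G k) (∑ k, eDiv K k * C (G k)) := by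
  intro j
  rw [Δt_sum, Δ_sum, map_sum, Finset.mul_sum]
  refine Finset.sum_congr rfl fun k _ => ?_
  rw [Δt_mul_C]
  by_cases hkj : k = j
  · subst hkj
    rw [eDiv_shift_symm_self, Δ, C_sub]
    ring
  · rw [hG.Δ_eq hkj, hG k j hkj, mul_div_assoc, div_eq_mul_one_div (G k), C_mul, C_mul]
    linear_combination (-C (G k)) * eDiv_shift_symm (K := K) hkj

theorem eDiv_degree_lt (k : Fin n) : (eDiv K k).degree < n := by
  have h1 : (eDiv K k).degree ≤ ∑ l ∈ Finset.univ.erase k, (1 : WithBot ℕ) := by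
    unfold eDiv
    refine (Polynomial.degree_prod_le _ _).trans (Finset.sum_le_sum fun l _ => ?_)
    rw [add_comm, ← C_1]
    exact degree_linear_le
  refine h1.trans_lt ?_
  -- The index `k` guarantees `n > 0`, so that the truncated `n - 1` is smaller than `n`.
  have h2 := k.pos
  simp only [Finset.sum_const, Finset.card_erase_of_mem (Finset.mem_univ k), Finset.card_univ,
    Fintype.card_fin, nsmul_eq_mul, mul_one]
  exact_mod_cast Nat.sub_lt h2 one_pos

theorem sum_eDiv_mul_C_degree_lt (G : Fin n → RatH K n) :
    (∑ k, eDiv K k * C (G k)).degree < n := by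
  refine mem_degreeLT.1 (Submodule.sum_mem _ fun k _ => mem_degreeLT.2 ?_)
  refine lt_of_le_of_lt ?_ (eDiv_degree_lt (K := K) k)
  rw [mul_comm]
  exact (degree_mul_le _ _).trans (add_le_of_nonpos_left degree_C_le)

/-! ### Decompositions of elements of `𝒲̄` and `𝒲`, and coefficients in `Ū(n)`. -/

theorem exists_sum_of_mem_iSup_range {M N : Type*} [AddCommGroup M] [Module K M]
    [AddCommGroup N] [Module K N] (f : Fin n → M →ₗ[K] N) {y : N}
    (hy : y ∈ ⨆ j, LinearMap.range (f j)) : ∃ m : Fin n → M, y = ∑ j, f j (m j) := by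
  have h1 : ⨆ j, LinearMap.range (f j) ≤
      LinearMap.range (∑ j, (f j) ∘ₗ LinearMap.proj (R := K) (φ := fun _ : Fin n => M) j) := by
    refine iSup_le fun j => ?_
    rintro _ ⟨m, rfl⟩
    refine ⟨Pi.single j m, ?_⟩
    rw [LinearMap.sum_apply, Finset.sum_eq_single j]
    · simp
    · intro l _ hl
      simp [Pi.single_eq_of_ne hl]
    · simp
  obtain ⟨m, hm⟩ := h1 hy
  refine ⟨m, ?_⟩
  rw [← hm, LinearMap.sum_apply]
  rfl

theorem exists_isWeightFamily_of_mem_Wbar {σ : RatH K n} (hσ : σ ∈ Wbar K n) :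
    ∃ G : Fin n → RatH K n, IsWeightFamily K G ∧ σ = ∑ k, G k := by
  obtain ⟨r, hr⟩ := exists_sum_of_mem_iSup_range _ hσ
  refine ⟨fun k => ratEval K k (r k) / χ K k,
    isWeightFamily_div_χ _ fun k j hkj => ratEval_shift_symm hkj _, ?_⟩
  rw [hr]
  exact Finset.sum_congr rfl fun k _ => (div_eq_inv_mul _ _).symm

theorem exists_polynomial_of_mem_W {σ : RatH K n} (hσ : σ ∈ W K n) :
    ∃ π : Fin n → K[X], σ = ∑ k, aeval (h K k) (π k) / χ K k := by
  obtain ⟨r, hr⟩ := exists_sum_of_mem_iSup_range _ hσ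
  refine ⟨r, ?_⟩
  rw [hr]
  exact Finset.sum_congr rfl fun k _ => (div_eq_inv_mul _ _).symm

theorem eDiv_coeff_mem_Ubar (k : Fin n) (m : ℕ) : (eDiv K k).coeff m ∈ Ubar K n := by
  rw [← (CoeffRing.ubar K n).eDivB_map, Polynomial.coeff_map]
  exact (((CoeffRing.ubar K n).eDivB k).coeff m).2

theorem aeval_div_χ_mem_Ubar (k : Fin n) (p : K[X]) : aeval (h K k) p / χ K k ∈ Ubar K n := by
  have h1 : aeval (h K k) p ∈ Ubar K n := by
    have h2 := Polynomial.aeval_algHom_apply (Ubar K n).val ⟨h K k, h_mem_Ubar k⟩ p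
    change aeval (h K k) p = _ at h2
    rw [h2]
    exact Subtype.coe_prop _
  rw [div_eq_mul_inv, χ, ← Finset.prod_inv_distrib]
  exact mul_mem h1 (prod_mem fun s hs => hd_inv_mem_Ubar (Finset.ne_of_mem_erase hs).symm)

end HDiff

/-! ### Translation-invariant rational functions are constant. -/

namespace HDiff

variable {K : Type*} [Field K] {n : ℕ}

/-- Cross-multiplied invariance of the fraction `p / q` under translations by vectors of natural
numbers. -/
theorem translate_mul_eq {p q : MvPolynomial (Fin n) K} (hq : q ≠ 0)
    (hpq : ∀ j, shiftPoly K j p * q = p * shiftPoly K j q) (m : Fin n →₀ ℕ) :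
    MvPolynomial.aeval (fun i => MvPolynomial.X i + MvPolynomial.C (m i : K)) p * q =
      p * MvPolynomial.aeval (fun i => MvPolynomial.X i + MvPolynomial.C (m i : K)) q := by
  -- Endomorphisms preserving `p / q` are closed under composition: apply `T` to the identity for
  -- `S`, combine it with the identity for `T`, and cancel `T q`.
  have key : ∀ (T S : MvPolynomial (Fin n) K →ₐ[K] MvPolynomial (Fin n) K), T q ≠ 0 →
      S p * q = p * S q → T p * q = p * T q → T (S p) * q = p * T (S q) := by
    intro T S hT hS hTq
    have h1 := congrArg T hS
    rw [map_mul, map_mul] at h1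
    refine mul_right_cancel₀ hT ?_
    linear_combination q * h1 + T (S q) * hTq
  have hinj : ∀ m : Fin n →₀ ℕ, MvPolynomial.aeval
      (fun i => MvPolynomial.X i + MvPolynomial.C (m i : K)) q ≠ 0 := by
    intro m h0
    apply hq
    have h1 := congrArg (MvPolynomial.aeval (R := K)
      fun i : Fin n => MvPolynomial.X i - MvPolynomial.C (m i : K)) h0
    rw [← AlgHom.comp_apply, map_zero] at h1
    have h2 : (MvPolynomial.aeval (R := K)
        fun i : Fin n => MvPolynomial.X i - MvPolynomial.C (m i : K)).comp
        (MvPolynomial.aeval fun i => MvPolynomial.X i + MvPolynomial.C (m i : K)) =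
        AlgHom.id K _ := by
      ext i : 1
      simp [← MvPolynomial.algebraMap_eq]
    rw [h2] at h1
    exact h1
  have hadd : ∀ m m' : Fin n →₀ ℕ,
      (MvPolynomial.aeval (fun i : Fin n => MvPolynomial.X i + MvPolynomial.C ((m + m') i : K)) :
        MvPolynomial (Fin n) K →ₐ[K] MvPolynomial (Fin n) K) =
      (MvPolynomial.aeval fun i => MvPolynomial.X i + MvPolynomial.C (m i : K)).comp
        (MvPolynomial.aeval fun i => MvPolynomial.X i + MvPolynomial.C (m' i : K)) := by
    intro m m'
    ext i : 1
    simp [add_assoc]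
  have hadd' : ∀ m m' : Fin n →₀ ℕ,
      MvPolynomial.aeval (fun i => MvPolynomial.X i + MvPolynomial.C (m i : K)) p * q =
        p * MvPolynomial.aeval (fun i => MvPolynomial.X i + MvPolynomial.C (m i : K)) q →
      MvPolynomial.aeval (fun i => MvPolynomial.X i + MvPolynomial.C (m' i : K)) p * q =
        p * MvPolynomial.aeval (fun i => MvPolynomial.X i + MvPolynomial.C (m' i : K)) q →
      MvPolynomial.aeval (fun i => MvPolynomial.X i + MvPolynomial.C ((m + m') i : K)) p * q =
        p * MvPolynomial.aeval (fun i => MvPolynomial.X i + MvPolynomial.C ((m + m') i : K)) q := by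
    intro m m' h1 h2
    rw [hadd, AlgHom.comp_apply, AlgHom.comp_apply]
    exact key _ _ (hinj m) h2 h1
  have hzero : MvPolynomial.aeval
        (fun i => MvPolynomial.X i + MvPolynomial.C ((0 : Fin n →₀ ℕ) i : K)) p * q =
      p * MvPolynomial.aeval
        (fun i => MvPolynomial.X i + MvPolynomial.C ((0 : Fin n →₀ ℕ) i : K)) q := by
    simp
  induction m using Finsupp.induction_linear with
  | zero => exact hzero
  | add m m' h1 h2 => exact hadd' m m' h1 h2
  | single j a =>
    induction a with
    | zero => rw [Finsupp.single_zero]; exact hzero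
    | succ a ih =>
      rw [Finsupp.single_add]
      refine hadd' _ _ ih ?_
      have h1 : (fun i : Fin n => (MvPolynomial.X i : MvPolynomial (Fin n) K) +
          MvPolynomial.C ((Finsupp.single j 1 i : ℕ) : K)) =
          fun i => MvPolynomial.X i + (if i = j then 1 else 0) := by
        funext i
        by_cases hij : i = j
        · simp [hij]
        · simp [hij]
      rw [h1]
      exact hpq j

/-- Over a field of characteristic zero, the only rational functions that are invariant under all
translations are the constants. -/
theorem exists_eq_algebraMap_of_shift_fixed [CharZero K] {f : RatH K n}
    (hf : ∀ j, shift K j f = f) : ∃ a : K, f = algebraMap K (RatH K n) a := by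
  obtain ⟨p, q, hq0, rfl⟩ := IsFractionRing.div_surjective (A := MvPolynomial (Fin n) K) f
  have hq : q ≠ 0 := nonZeroDivisors.ne_zero hq0
  have hinj := IsFractionRing.injective (MvPolynomial (Fin n) K) (RatH K n)
  have hne : ∀ r : MvPolynomial (Fin n) K, r ≠ 0 → algebraMap _ (RatH K n) r ≠ 0 :=
    fun r hr => (map_ne_zero_iff _ hinj).2 hr
  have hpq : ∀ j, shiftPoly K j p * q = p * shiftPoly K j q := by
    intro j
    have h1 := hf j
    have h2 : ∀ r, shift K j (algebraMap _ (RatH K n) r) =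
        algebraMap _ (RatH K n) (shiftPoly K j r) := fun r => by
      unfold shift
      rw [IsFractionRing.fieldEquivOfAlgEquiv_algebraMap]
    rw [map_div₀, h2, h2, div_eq_div_iff
      (hne _ ((map_ne_zero_iff _ (shiftPoly K j).injective).2 hq)) (hne _ hq)] at h1
    apply hinj
    rw [map_mul, map_mul, h1]
  obtain ⟨v, hv⟩ : ∃ v : Fin n → K, MvPolynomial.eval v q ≠ 0 := by
    by_contra! h0
    exact hq (MvPolynomial.funext fun v => by rw [h0 v, map_zero])
  -- The value of `p / q` at `v` is its constant value. The cross-multiplied identity is tested on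
  -- the grid of points `v + a`, `a ∈ ℕⁿ`; in characteristic zero each side of this grid is
  -- infinite, which suffices for equality of polynomials.
  have hconst : MvPolynomial.C (MvPolynomial.eval v q) * p =
      MvPolynomial.C (MvPolynomial.eval v p) * q := by
    refine MvPolynomial.funext_set (fun i => Set.range fun a : ℕ => v i + (a : K))
      (fun i => Set.infinite_range_of_injective fun a b hab => ?_) fun w hw => ?_
    · exact Nat.cast_injective (add_left_cancel hab)
    · choose a ha using fun i => hw i (Set.mem_univ i)
      -- Evaluating at `v` the identity translated by `a` gives `p(w) q(v) = p(v) q(w)` for `w = v +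
      -- a`.
      have h1 := congrArg (MvPolynomial.eval v)
        (translate_mul_eq hq hpq (Finsupp.equivFunOnFinite.symm a))
      have h2 : ∀ r : MvPolynomial (Fin n) K, MvPolynomial.eval v (MvPolynomial.aeval
          (fun i => MvPolynomial.X i +
            MvPolynomial.C ((Finsupp.equivFunOnFinite.symm a) i : K)) r) =
          MvPolynomial.eval w r := by
        intro r
        have h3 : (MvPolynomial.aeval v).comp (MvPolynomial.aeval fun i => MvPolynomial.X i +
            MvPolynomial.C ((Finsupp.equivFunOnFinite.symm a) i : K)) =
            (MvPolynomial.aeval w : MvPolynomial (Fin n) K →ₐ[K] K) := by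
          ext i
          simp [← ha i, ← MvPolynomial.algebraMap_eq]
        have h4 := DFunLike.congr_fun h3 r
        simpa [MvPolynomial.coe_aeval_eq_eval] using h4
      rw [map_mul, map_mul, h2, h2] at h1
      rw [map_mul, map_mul, MvPolynomial.eval_C, MvPolynomial.eval_C, mul_comm, h1]
  refine ⟨MvPolynomial.eval v p / MvPolynomial.eval v q, ?_⟩
  have h1 := congrArg (algebraMap _ (RatH K n)) hconst
  rw [map_mul, map_mul, ← MvPolynomial.algebraMap_eq, ← IsScalarTower.algebraMap_apply,
    ← IsScalarTower.algebraMap_apply] at h1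
  rw [map_div₀, div_eq_div_iff (hne _ hq) ((map_ne_zero_iff _ (algebraMap K _).injective).2 hv),
    mul_comm, h1]

end HDiff

/-! ### Representation by difference operators, and necessity of the system. -/

namespace HDiff

variable {K : Type*} [Field K] {n : ℕ}

variable (K) in
/-- The product of the `h̃_{il}` over `l > i`. -/
def upperProd (i : Fin n) : RatH K n := ∏ l ∈ Finset.Ioi i, hd K i l

theorem upperProd_ne_zero (i : Fin n) : upperProd K i ≠ 0 :=
  Finset.prod_ne_zero_iff.2 fun _ hl => hd_ne_zero (Finset.mem_Ioi.1 hl).ne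

theorem upperProd_shift_of_lt {i j : Fin n} (hij : i < j) :
    shift K j (upperProd K i) = upperProd K i * (hd K i j - 1) / hd K i j := by
  have h1 := map_prod_mul_of_fixed (shift K j : RatH K n →+* RatH K n) (Finset.Ioi i) (hd K i)
    (Finset.mem_Ioi.2 hij) (fun l _ hl => by
      change shift K j (hd K i l) = hd K i l
      simp [shift_hd, hij.ne, hl])
  have h2 : (shift K j : RatH K n →+* RatH K n) (hd K i j) = hd K i j - 1 := by
    change shift K j (hd K i j) = hd K i j - 1
    simp [shift_hd, hij.ne, sub_eq_add_neg]
  rw [h2] at h1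
  rw [eq_div_iff (hd_ne_zero hij.ne)]
  exact h1

theorem upperProd_shift_of_gt {i j : Fin n} (hij : j < i) :
    shift K j (upperProd K i) = upperProd K i := by
  unfold upperProd
  rw [map_prod]
  refine Finset.prod_congr rfl fun l hl => ?_
  simp [shift_hd, hij.ne', (hij.trans (Finset.mem_Ioi.1 hl)).ne']

theorem upperProd_shift_symm_of_gt {i j : Fin n} (hij : j < i) :
    (shift K j).symm (upperProd K i) = upperProd K i := by
  rw [AlgEquiv.symm_apply_eq, upperProd_shift_of_gt hij]

theorem upperProd_shift_symm_of_lt {i j : Fin n} (hij : i < j) :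
    (shift K j).symm (upperProd K i) = upperProd K i * (hd K i j + 1) / hd K i j := by
  have h3 := hd_ne_zero (K := K) hij.ne
  have h4 := hd_sub_one_ne_zero (K := K) hij.ne
  rw [AlgEquiv.symm_apply_eq, map_div₀, map_mul, map_add, map_one, upperProd_shift_of_lt hij,
    shift_hd]
  simp only [hij.ne, if_true, if_false, zero_sub, ← sub_eq_add_neg, sub_add_cancel]
  field_simp

variable (K) in
/-- The difference operator on `K(n)` that represents `x^i`. -/
def opX (i : Fin n) : Module.End K (RatH K n) :=
  LinearMap.mulLeft K (upperProd K i)⁻¹ ∘ₗ (shift K i).symm.toLinearMap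

/-- The difference operator on `K(n)` that represents `∂̄_i`; then `Γ_i` is represented by the
multiplication by `G_i`. -/
def opD (G : Fin n → RatH K n) (i : Fin n) : Module.End K (RatH K n) :=
  LinearMap.mulLeft K (G i * shift K i (upperProd K i)) ∘ₗ (shift K i).toLinearMap

theorem opX_apply (i : Fin n) (f : RatH K n) :
    opX K i f = (upperProd K i)⁻¹ * (shift K i).symm f := rfl

theorem opD_apply (G : Fin n → RatH K n) (i : Fin n) (f : RatH K n) :
    opD G i f = G i * shift K i (upperProd K i) * shift K i f := rfl

/-- The factor `shift K i (upperProd K i)` in `opD` is there to cancel the translated denominator of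
`opX`. -/
theorem opD_opX_apply (G : Fin n → RatH K n) (i : Fin n) (f : RatH K n) :
    opD G i (opX K i f) = G i * f := by
  have h1 : shift K i (upperProd K i) ≠ 0 :=
    (map_ne_zero_iff _ (shift K i).injective).2 (upperProd_ne_zero i)
  rw [opX_apply, opD_apply, map_mul, map_inv₀, AlgEquiv.apply_symm_apply]
  field_simp

theorem opX_opD_apply (G : Fin n → RatH K n) (i : Fin n) (f : RatH K n) :
    opX K i (opD G i f) = (shift K i).symm (G i) * f := by
  have h1 := upperProd_ne_zero (K := K) i
  rw [opD_apply, opX_apply, map_mul, map_mul, AlgEquiv.symm_apply_apply, AlgEquiv.symm_apply_apply]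
  field_simp

/-- The product over `l > i` provides the asymmetry of the relation: for `i < j`, `upperProd K i`
involves `h̃_j` but `upperProd K j` does not involve `h̃_i`. -/
theorem opX_opX_of_lt {i j : Fin n} (hij : i < j) (f : RatH K n) :
    opX K i (opX K j f) = (hd K i j + 1) / hd K i j * opX K j (opX K i f) := by
  have h1 := upperProd_ne_zero (K := K) i
  have h2 := upperProd_ne_zero (K := K) j
  have h3 := hd_ne_zero (K := K) hij.ne
  have h4 := hd_add_one_ne_zero (K := K) hij.ne
  simp only [opX_apply, map_mul, map_inv₀, upperProd_shift_symm_of_lt hij,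
    upperProd_shift_symm_of_gt hij]
  rw [shift_symm_comm i j]
  field_simp

theorem opD_opD_of_lt {G : Fin n → RatH K n} (hG : IsWeightFamily K G) {i j : Fin n}
    (hij : i < j) (f : RatH K n) :
    opD G i (opD G j f) = (hd K i j - 1) / hd K i j * opD G j (opD G i f) := by
  have h3 := hd_ne_zero (K := K) hij.ne
  have h4 := hd_add_one_ne_zero (K := K) hij.ne
  have h5 := hd_sub_one_ne_zero (K := K) hij.ne
  have h6 : shift K i (hd K i j) = hd K i j + 1 := by simp [shift_hd, hij.ne']
  have h7 : shift K i (shift K j (upperProd K j)) = shift K j (upperProd K j) := by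
    rw [shift_comm, upperProd_shift_of_gt hij]
  have h8 : shift K j (shift K i (upperProd K i)) =
      shift K i (upperProd K i) * hd K i j / (hd K i j + 1) := by
    rw [shift_comm, upperProd_shift_of_lt hij, map_div₀, map_mul, map_sub, map_one, h6]
    ring
  have h9 : shift K i (G j) = G j * hd K i j / (hd K i j + 1) := by
    rw [hG.shift hij.ne', hd_swap j i, ← neg_div_neg_eq]
    ring
  simp only [opD_apply, map_mul, h7, h8, h9, hG.shift hij.ne]
  rw [shift_comm i j f]
  field_simp

/-- Both orders produce the same factor `h̃_{ij} / (h̃_{ij} - 1)`: on the left from `G_j[-ε_i]`, on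
the right from translating the denominator `upperProd K i`. -/
theorem opX_opD_of_lt {G : Fin n → RatH K n} (hG : IsWeightFamily K G) {i j : Fin n}
    (hij : i < j) (f : RatH K n) : opX K i (opD G j f) = opD G j (opX K i f) := by
  have h1 := upperProd_ne_zero (K := K) i
  have h3 := hd_ne_zero (K := K) hij.ne
  have h5 := hd_sub_one_ne_zero (K := K) hij.ne
  have h7 : (shift K i).symm (shift K j (upperProd K j)) = shift K j (upperProd K j) := by
    rw [shift_symm_shift_comm, upperProd_shift_symm_of_gt hij]
  have h9 : (shift K i).symm (G j) = G j * hd K i j / (hd K i j - 1) := by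
    rw [hG j i hij.ne', hd_swap j i, ← neg_div_neg_eq]
    ring
  simp only [opX_apply, opD_apply, map_mul, map_inv₀, h7, h9, upperProd_shift_of_lt hij]
  rw [shift_symm_shift_comm i j f]
  field_simp

/-- Now both factors arise on the left: `h̃_{ij} / (h̃_{ij} - 1)` from `G_j` and `(h̃_{ij} - 2) /
(h̃_{ij} - 1)` from `upperProd K j`, while `ε_j` fixes `upperProd K i`. -/
theorem opX_opD_of_gt {G : Fin n → RatH K n} (hG : IsWeightFamily K G) {i j : Fin n}
    (hij : j < i) (f : RatH K n) :
    opX K i (opD G j f) =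
      hd K i j * (hd K i j - 2) / (hd K i j - 1) ^ 2 * opD G j (opX K i f) := by
  have h1 := upperProd_ne_zero (K := K) i
  have h3 := hd_ne_zero (K := K) hij.ne'
  have h4 := hd_sub_one_ne_zero (K := K) hij.ne'
  have h5 := hd_sub_two_ne_zero (K := K) hij.ne'
  have h6 : shift K j (hd K j i) = hd K j i + 1 := by simp [shift_hd, hij.ne']
  have h7 : (shift K i).symm (shift K j (upperProd K j)) =
      shift K j (upperProd K j) * (hd K i j - 2) / (hd K i j - 1) := by
    rw [shift_symm_shift_comm, upperProd_shift_symm_of_lt hij, map_div₀, map_mul, map_add,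
      map_one, h6, hd_swap j i, ← neg_div_neg_eq]
    ring
  have h9 : (shift K i).symm (G j) = G j * hd K i j / (hd K i j - 1) := by
    rw [hG j i hij.ne, hd_swap j i, ← neg_div_neg_eq]
    ring
  simp only [opX_apply, opD_apply, map_mul, map_inv₀, h7, h9, upperProd_shift_of_gt hij]
  rw [shift_symm_shift_comm i j f]
  field_simp

/-- This is what the relation for `x^i ∂̄_i` says under the representation. For `j ≠ i` the terms
cancel, because `Δ_i G_j = G_j / (h̃_{ji} + 1)` and `1 - h̃_{ij} = h̃_{ji} + 1`; the term `j = i` is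
`G_i - Δ_i G_i`. -/
theorem IsWeightFamily.shift_symm_self {G : Fin n → RatH K n} (hG : IsWeightFamily K G)
    (i : Fin n) : (HDiff.shift K i).symm (G i) =
      ∑ j, 1 / (1 - hd K i j) * G j - Δ K i (∑ j, G j) := by
  rw [Δ_sum, ← Finset.sum_sub_distrib, Finset.sum_eq_single i]
  · simp [hd_self, Δ]
  · intro j _ hji
    rw [hG.Δ_eq hji, hd_swap i j, sub_neg_eq_add, add_comm]
    ring
  · simp

namespace CoeffRing

variable (B : CoeffRing K n)

/-- The difference operators that represent the generators of the ring of `h`-deformed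
differential operators. -/
def genOp (G : Fin n → RatH K n) : B.Gen → Module.End K (RatH K n)
  | Gen.coeff b => LinearMap.mulLeft K (b : RatH K n)
  | Gen.x i => opX K i
  | Gen.d i => opD G i

theorem genOp_rel {G : Fin n → RatH K n} (hG : IsWeightFamily K G) (s : Fin n → B.carrier)
    (hs : ∀ j, (s j : RatH K n) = Δ K j (∑ k, G k)) ⦃a b : FreeAlgebra K B.Gen⦄
    (hab : B.Rel s a b) :
    FreeAlgebra.lift K (B.genOp G) a = FreeAlgebra.lift K (B.genOp G) b := by
  have hb : ∀ b, FreeAlgebra.lift K (B.genOp G) (B.fb b) = LinearMap.mulLeft K (b : RatH K n) :=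
    fun b => FreeAlgebra.lift_ι_apply _ _
  have hx : ∀ i, FreeAlgebra.lift K (B.genOp G) (B.fx i) = opX K i :=
    fun b => FreeAlgebra.lift_ι_apply _ _
  have hd : ∀ i, FreeAlgebra.lift K (B.genOp G) (B.fd i) = opD G i :=
    fun b => FreeAlgebra.lift_ι_apply _ _
  refine LinearMap.ext fun f => ?_
  cases hab with
  | coeff_add a b => simp [hb, add_mul]
  | coeff_mul a b => simp [hb]
  | coeff_scalar r => simp [hb, Algebra.smul_def]
  | weight_x j b =>
    simp only [map_mul, hb, hx, Module.End.mul_apply, LinearMap.mulLeft_apply, opX_apply, sh,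
      AlgEquiv.symm_apply_apply]
    ring
  | weight_d j b =>
    simp only [map_mul, hb, hd, Module.End.mul_apply, LinearMap.mulLeft_apply, opD_apply, shInv,
      AlgEquiv.apply_symm_apply]
    ring
  | xx i j hij =>
    simp only [map_mul, hb, hx, Module.End.mul_apply, LinearMap.mulLeft_apply]
    exact opX_opX_of_lt hij f
  | dd i j hij =>
    simp only [map_mul, hb, hd, Module.End.mul_apply, LinearMap.mulLeft_apply]
    exact opD_opD_of_lt hG hij f
  | xd_lt i j hij =>
    simp only [map_mul, hx, hd, Module.End.mul_apply]
    exact opX_opD_of_lt hG hij f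
  | xd_gt i j hij =>
    simp only [map_mul, hb, hx, hd, Module.End.mul_apply, LinearMap.mulLeft_apply]
    exact opX_opD_of_gt hG hij f
  | xd_diag i =>
    simp only [map_mul, map_sub, map_sum, hb, hx, hd, Module.End.mul_apply, LinearMap.sub_apply,
      LinearMap.sum_apply, LinearMap.mulLeft_apply, opD_opX_apply, opX_opD_apply, hs,
      hG.shift_symm_self i, sub_mul, Finset.sum_mul]
    congr 1
    exact Finset.sum_congr rfl fun j _ => mul_assoc _ _ _

/-- The representation of the ring of `h`-deformed differential operators by difference operators
on `K(n)` that is attached to a decomposition `σ = ∑ G_k` with `G_k` in `𝒲̄_k`. -/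
def rep {G : Fin n → RatH K n} (hG : IsWeightFamily K G) (s : Fin n → B.carrier)
    (hs : ∀ j, (s j : RatH K n) = Δ K j (∑ k, G k)) :
    B.Diff s →ₐ[K] Module.End K (RatH K n) :=
  RingQuot.liftAlgHom K ⟨FreeAlgebra.lift K (B.genOp G), B.genOp_rel hG s hs⟩

section

variable {G : Fin n → RatH K n} (hG : IsWeightFamily K G) (s : Fin n → B.carrier)
    (hs : ∀ j, (s j : RatH K n) = Δ K j (∑ k, G k))

theorem rep_coeffHom (b : B.carrier) (f : RatH K n) :
    B.rep hG s hs (B.coeffHom s b) f = b * f := by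
  unfold rep
  change (RingQuot.liftAlgHom K ⟨FreeAlgebra.lift K (B.genOp G), B.genOp_rel hG s hs⟩
    (RingQuot.mkAlgHom K (B.Rel s) (B.fb b)) : Module.End K (RatH K n)) f = _
  rw [RingQuot.liftAlgHom_mkAlgHom_apply, fb, FreeAlgebra.lift_ι_apply]
  rfl

theorem rep_x (i : Fin n) : B.rep hG s hs (B.x s i) = opX K i := by
  unfold rep x
  rw [RingQuot.liftAlgHom_mkAlgHom_apply, fx, FreeAlgebra.lift_ι_apply]
  rfl

theorem rep_d (i : Fin n) : B.rep hG s hs (B.d s i) = opD G i := by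
  unfold rep d
  rw [RingQuot.liftAlgHom_mkAlgHom_apply, fd, FreeAlgebra.lift_ι_apply]
  rfl

theorem rep_Γ (i : Fin n) (f : RatH K n) : B.rep hG s hs (B.Γ s i) f = G i * f := by
  rw [Γ, map_mul, rep_d, rep_x]
  exact opD_opX_apply G i f

end

theorem c_coeff (s : Fin n → B.carrier) (ρ : B.carrier[X]) (m : ℕ) :
    (B.c s ρ).coeff m = ∑ i, B.coeffHom s ((B.eDivB i).coeff m) * B.Γ s i -
      B.coeffHom s (ρ.coeff m) := by
  simp only [c, coeff_sub, finsetSum_coeff, coeff_mul_C, coeff_map]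

theorem coe_eDivB_coeff (i : Fin n) (m : ℕ) :
    (((B.eDivB i).coeff m : B.carrier) : RatH K n) = (eDiv K i).coeff m := by
  rw [← B.eDivB_map, coeff_map]
  rfl

/-- The coefficients of `c(t)` act by multiplication, so commutation in the ring turns into
equations in the field `K(n)`. -/
theorem rep_c_coeff {G : Fin n → RatH K n} (hG : IsWeightFamily K G) (s : Fin n → B.carrier)
    (hs : ∀ j, (s j : RatH K n) = Δ K j (∑ k, G k)) (ρ : B.carrier[X]) (m : ℕ) (f : RatH K n) :
    B.rep hG s hs ((B.c s ρ).coeff m) f =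
      (∑ i, eDiv K i * C (G i) - ρ.map (algebraMap B.carrier (RatH K n))).coeff m * f := by
  rw [c_coeff, map_sub, map_sum, LinearMap.sub_apply, LinearMap.sum_apply, rep_coeffHom,
    coeff_sub, finsetSum_coeff, sub_mul, Finset.sum_mul, coeff_map]
  congr 1
  refine Finset.sum_congr rfl fun i _ => ?_
  rw [map_mul, Module.End.mul_apply, rep_coeffHom, rep_Γ, coe_eDivB_coeff, coeff_mul_C, mul_assoc]

theorem solves_of_central {σ : RatH K n} (hσ : σ ∈ Wbar K n) (s : Fin n → B.carrier)
    (hs : ∀ j, (s j : RatH K n) = Δ K j σ) {ρ : B.carrier[X]} (hρ : ρ.degree < n)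
    (hc : ∀ k : Fin n, (B.c s ρ).coeff k ∈ Set.center (B.Diff s)) :
    Solves K n σ (ρ.map (algebraMap B.carrier (RatH K n))) := by
  obtain ⟨G, hG, rfl⟩ := exists_isWeightFamily_of_mem_Wbar hσ
  -- Centrality is assumed only for the coefficients of index below `n`; the degree bound disposes
  -- of the others.
  have hdeg : (∑ i, eDiv K i * C (G i) - ρ.map (algebraMap B.carrier (RatH K n))).degree < n :=
    (degree_sub_le _ _).trans_lt
      (max_lt (sum_eDiv_mul_C_degree_lt G) (degree_map_le.trans_lt hρ))
  have hinv : ∀ j, Δt K j (∑ i, eDiv K i * C (G i) -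
      ρ.map (algebraMap B.carrier (RatH K n))) = 0 := by
    intro j
    ext m
    rw [Δt_coeff, coeff_zero]
    by_cases hm : m < n
    -- Applying the commutation with `x^j` to the function `1` leaves the invariance of the
    -- coefficient under `-ε_j`, up to the nonzero factor `1 / upperProd K j`.
    · have h1 := congrArg (fun T => B.rep hG s hs T 1)
        ((Set.mem_center_iff.1 (hc ⟨m, hm⟩)).comm (B.x s j))
      simp only [map_mul, Module.End.mul_apply, rep_x, rep_c_coeff, opX_apply, map_one,
        mul_one] at h1
      rw [mul_comm] at h1
      exact sub_eq_zero.2 (mul_left_cancel₀ (inv_ne_zero (upperProd_ne_zero j)) h1)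
    · rw [coeff_eq_zero_of_degree_lt (hdeg.trans_le (by exact_mod_cast not_lt.1 hm))]
      simp [Δ]
  intro j
  have h1 := hinv j
  rw [Δt_sub, hG.solves j, sub_eq_zero] at h1
  exact h1.symm

end CoeffRing

end HDiff

/-! ### Commutation relations in the ring, and sufficiency of the system. -/

namespace HDiff

variable {K : Type*} [Field K] {n : ℕ}

namespace CoeffRing

variable (B : CoeffRing K n) (s : Fin n → B.carrier)

theorem coeffHom_mul_x (j : Fin n) (b : B.carrier) :
    B.coeffHom s b * B.x s j = B.x s j * B.coeffHom s (B.sh j b) := by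
  have h1 := RingQuot.mkAlgHom_rel K (Rel.weight_x (s := s) j b)
  rwa [map_mul, map_mul] at h1

theorem coeffHom_mul_d (j : Fin n) (b : B.carrier) :
    B.coeffHom s b * B.d s j = B.d s j * B.coeffHom s (B.shInv j b) := by
  have h1 := RingQuot.mkAlgHom_rel K (Rel.weight_d (s := s) j b)
  rwa [map_mul, map_mul] at h1

theorem x_mul_coeffHom (j : Fin n) (b : B.carrier) :
    B.x s j * B.coeffHom s b = B.coeffHom s (B.shInv j b) * B.x s j := by
  rw [coeffHom_mul_x]
  congr 2
  exact Subtype.ext ((shift K j).apply_symm_apply b).symm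

theorem d_mul_coeffHom (j : Fin n) (b : B.carrier) :
    B.d s j * B.coeffHom s b = B.coeffHom s (B.sh j b) * B.d s j := by
  rw [coeffHom_mul_d]
  congr 2
  exact Subtype.ext ((shift K j).symm_apply_apply b).symm

theorem coeffHom_mul_Γ (i : Fin n) (b : B.carrier) :
    B.coeffHom s b * B.Γ s i = B.Γ s i * B.coeffHom s b := by
  rw [Γ, ← mul_assoc, coeffHom_mul_d, mul_assoc, mul_assoc, x_mul_coeffHom]

theorem x_mul_x {i j : Fin n} (hij : i < j) :
    B.x s i * B.x s j = B.coeffHom s (B.cxx hij.ne) * B.x s j * B.x s i := by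
  have h1 := RingQuot.mkAlgHom_rel K (Rel.xx (B := B) (s := s) i j hij)
  rwa [map_mul, map_mul, map_mul] at h1

theorem d_mul_d {i j : Fin n} (hij : i < j) :
    B.d s i * B.d s j = B.coeffHom s (B.cdd hij.ne) * B.d s j * B.d s i := by
  have h1 := RingQuot.mkAlgHom_rel K (Rel.dd (B := B) (s := s) i j hij)
  rwa [map_mul, map_mul, map_mul] at h1

theorem x_mul_d_of_lt {i j : Fin n} (hij : i < j) :
    B.x s i * B.d s j = B.d s j * B.x s i := by
  have h1 := RingQuot.mkAlgHom_rel K (Rel.xd_lt (B := B) (s := s) i j hij)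
  rwa [map_mul, map_mul] at h1

theorem x_mul_d_of_gt {i j : Fin n} (hij : j < i) :
    B.x s i * B.d s j = B.coeffHom s (B.cxd hij.ne') * B.d s j * B.x s i := by
  have h1 := RingQuot.mkAlgHom_rel K (Rel.xd_gt (B := B) (s := s) i j hij)
  rwa [map_mul, map_mul, map_mul] at h1

theorem x_mul_d_self (i : Fin n) :
    B.x s i * B.d s i =
      ∑ j, B.coeffHom s (B.cdiag i j) * B.Γ s j - B.coeffHom s (s i) := by
  have h1 := RingQuot.mkAlgHom_rel K (Rel.xd_diag (B := B) (s := s) i)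
  rw [map_mul, map_sub, map_sum] at h1
  refine h1.trans (congrArg₂ _ (Finset.sum_congr rfl fun j _ => ?_) rfl)
  rw [map_mul, map_mul, mul_assoc]
  rfl

/-- `h̃_{ij} / (h̃_{ij} + 1)`, for `i ≠ j`. -/
def cxΓ {i j : Fin n} (hij : i ≠ j) : B.carrier :=
  B.ofUbar (hd K i j / (hd K i j + 1)) (by
    rw [div_eq_mul_inv]
    have h1 := inv_mem_Ubar (K := K) hij 1
    rw [Int.cast_one] at h1
    exact mul_mem (hd_mem_Ubar i j) h1)

theorem x_mul_Γ {i j : Fin n} (hij : i ≠ j) :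
    B.x s j * B.Γ s i = B.coeffHom s (B.cxΓ hij) * B.Γ s i * B.x s j := by
  have h3 := hd_ne_zero (K := K) hij
  have h4 := hd_add_one_ne_zero (K := K) hij
  rw [Γ]
  rcases hij.lt_or_gt with h | h
  -- The relation for `x^i x^j` must be read backwards here; splitting off its coefficient,
  -- translated past `∂̄_i`, avoids inverting it.
  · have h5 : B.cxd h.ne' = B.cxΓ hij * B.sh i (B.cxx h.ne) := by
      apply Subtype.ext
      change hd K j i * (hd K j i - 2) / (hd K j i - 1) ^ 2 =
        hd K i j / (hd K i j + 1) * shift K i ((hd K i j + 1) / hd K i j)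
      have h6 : shift K i (hd K i j) = hd K i j + 1 := by simp [shift_hd, hij.symm]
      have h7 : -hd K i j - 1 ≠ 0 := by
        rw [← neg_add']
        exact neg_ne_zero.2 h4
      rw [map_div₀, map_add, map_one, h6, hd_swap j i]
      field_simp
      ring
    calc B.x s j * (B.d s i * B.x s i)
        = B.coeffHom s (B.cxd h.ne') * B.d s i * (B.x s j * B.x s i) := by
          rw [← mul_assoc, x_mul_d_of_gt B s h, mul_assoc]
      _ = B.coeffHom s (B.cxΓ hij) * (B.d s i * B.coeffHom s (B.cxx h.ne)) *
            (B.x s j * B.x s i) := by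
          rw [h5, map_mul, d_mul_coeffHom]
          simp only [mul_assoc]
      _ = B.coeffHom s (B.cxΓ hij) * B.d s i * (B.x s i * B.x s j) := by
          rw [x_mul_x B s h]
          simp only [mul_assoc]
      _ = _ := by simp only [mul_assoc]
  · have h5 : B.cxΓ hij = B.sh i (B.cxx h.ne) := by
      apply Subtype.ext
      change hd K i j / (hd K i j + 1) = shift K i ((hd K j i + 1) / hd K j i)
      have h6 : shift K i (hd K j i) = hd K j i - 1 := by
        simp [shift_hd, hij.symm, sub_eq_add_neg]
      rw [map_div₀, map_add, map_one, h6, hd_swap j i, ← neg_div_neg_eq]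
      ring
    calc B.x s j * (B.d s i * B.x s i)
        = B.d s i * (B.x s j * B.x s i) := by
          rw [← mul_assoc, x_mul_d_of_lt B s h, mul_assoc]
      _ = B.d s i * B.coeffHom s (B.cxx h.ne) * (B.x s i * B.x s j) := by
          rw [x_mul_x B s h]
          simp only [mul_assoc]
      _ = _ := by
          rw [h5, d_mul_coeffHom]
          simp only [mul_assoc]

theorem Γ_mul_d {i j : Fin n} (hij : i ≠ j) :
    B.Γ s i * B.d s j = B.d s j * (B.coeffHom s (B.cxΓ hij) * B.Γ s i) := by
  have h3 := hd_ne_zero (K := K) hij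
  have hu : ((B.sh j (B.cxΓ hij) : B.carrier) : RatH K n) = (hd K i j - 1) / hd K i j := by
    change shift K j (hd K i j / (hd K i j + 1)) = _
    have h6 : shift K j (hd K i j) = hd K i j - 1 := by simp [shift_hd, hij, sub_eq_add_neg]
    rw [map_div₀, map_add, map_one, h6]
    ring
  rw [Γ, ← mul_assoc (B.d s j), d_mul_coeffHom]
  rcases hij.lt_or_gt with h | h
  · have h5 : B.sh j (B.cxΓ hij) = B.cdd h.ne := Subtype.ext hu
    rw [h5, mul_assoc, x_mul_d_of_lt B s h, ← mul_assoc, d_mul_d B s h]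
    simp only [mul_assoc]
  -- The `x^i ∂̄_j` coefficient, once moved past `∂̄_i`, contains the coefficient that reorders
  -- `∂̄_j ∂̄_i`.
  · have h5 : B.sh i (B.cxd h.ne') = B.sh j (B.cxΓ hij) * B.cdd h.ne := by
      apply Subtype.ext
      rw [MulMemClass.coe_mul, hu]
      change shift K i (hd K i j * (hd K i j - 2) / (hd K i j - 1) ^ 2) =
        (hd K i j - 1) / hd K i j * ((hd K j i - 1) / hd K j i)
      have h6 : shift K i (hd K i j) = hd K i j + 1 := by simp [shift_hd, hij.symm]
      rw [map_div₀, map_mul, map_pow, map_sub, map_sub, map_one, map_ofNat, h6, hd_swap j i,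
        add_sub_cancel_right]
      field_simp
      ring
    rw [mul_assoc, x_mul_d_of_gt B s h, ← mul_assoc, ← mul_assoc, d_mul_coeffHom, h5, map_mul,
      mul_assoc (B.coeffHom s (B.sh j (B.cxΓ hij))) (B.d s j), ← mul_assoc (B.d s j) (B.d s i),
      d_mul_d B s h]
    simp only [mul_assoc]

/-- Coefficientwise form of `eDiv_shift_symm`, with the error term written through `1 / (1 -
h̃_{ji})` so that it matches the relation for `x^j ∂̄_j`. -/
theorem eDivB_coeff_exchange {i j : Fin n} (hij : i ≠ j) (m : ℕ) :
    B.shInv j ((B.eDivB i).coeff m) * B.cxΓ hij =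
      (B.eDivB i).coeff m - (B.eDivB j).coeff m * B.cdiag j i := by
  have h1 := congrArg (fun p => p.coeff m) (eDiv_shift_symm (K := K) hij)
  simp only [coeff_add, coeff_mul_C, coeff_map] at h1
  have h2 : 1 / (1 - hd K j i) = 1 / (hd K i j + 1) := by
    rw [hd_swap j i, sub_neg_eq_add, add_comm]
  apply Subtype.ext
  rw [MulMemClass.coe_mul, AddSubgroupClass.coe_sub, MulMemClass.coe_mul, coe_eDivB_coeff,
    coe_eDivB_coeff]
  change (shift K j).symm (((B.eDivB i).coeff m : B.carrier) : RatH K n) *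
    (hd K i j / (hd K i j + 1)) = (eDiv K i).coeff m - (eDiv K j).coeff m * (1 / (1 - hd K j i))
  rw [h2, coe_eDivB_coeff]
  exact eq_sub_of_add_eq h1

theorem shInv_eDivB_coeff_self (j : Fin n) (m : ℕ) :
    B.shInv j ((B.eDivB j).coeff m) = (B.eDivB j).coeff m := by
  have h1 := congrArg (fun p => p.coeff m) (eDiv_shift_symm_self (K := K) j)
  simp only [coeff_map] at h1
  apply Subtype.ext
  rw [coe_eDivB_coeff]
  change (shift K j).symm (((B.eDivB j).coeff m : B.carrier) : RatH K n) = _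
  rw [coe_eDivB_coeff]
  exact h1

theorem cdiag_self (j : Fin n) : B.cdiag j j = 1 := by
  apply Subtype.ext
  change 1 / (1 - hd K j j) = 1
  simp [hd_self]

section

variable {s} {ρ : B.carrier[X]} {j : Fin n} {m : ℕ}

/-- The sum over `i` of the terms into which the exchange relations decompose the commutation of
`x^j` and `∂̄_j` with the coefficients of `c(t)`. -/
theorem sum_exchange
    (hρ : ρ.coeff m - B.shInv j (ρ.coeff m) = (B.eDivB j).coeff m * s j) :
    ∑ i, ((B.coeffHom s ((B.eDivB i).coeff m) * B.Γ s i -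
        B.coeffHom s ((B.eDivB j).coeff m * B.cdiag j i) * B.Γ s i) +
        (if i = j then B.coeffHom s ((B.eDivB j).coeff m) *
          (∑ k, B.coeffHom s (B.cdiag j k) * B.Γ s k - B.coeffHom s (s j)) else 0)) -
      B.coeffHom s (B.shInv j (ρ.coeff m)) = (B.c s ρ).coeff m := by
  have h1 : ρ.coeff m = B.shInv j (ρ.coeff m) + (B.eDivB j).coeff m * s j := by
    rw [← hρ]; abel
  rw [c_coeff, Finset.sum_add_distrib, Finset.sum_sub_distrib, Finset.sum_ite_eq',
    if_pos (Finset.mem_univ j), mul_sub, Finset.mul_sum]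
  conv_rhs => rw [h1]
  simp only [map_mul, map_add, mul_assoc]
  abel

/-- Moving `x^j` to the right past the `i`-th summand, `i ≠ j`, subtracts a multiple of `Γ_i`; the
summand `i = j` turns into `x^j ∂̄_j x^j`, whose expansion restores all these multiples and leaves
only the `σ_j` term, matched by `hρ`. -/
theorem x_mul_c_coeff
    (hρ : ρ.coeff m - B.shInv j (ρ.coeff m) = (B.eDivB j).coeff m * s j) :
    B.x s j * (B.c s ρ).coeff m = (B.c s ρ).coeff m * B.x s j := by
  conv_rhs => rw [← B.sum_exchange hρ]
  rw [c_coeff, mul_sub, sub_mul, x_mul_coeffHom,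
    Finset.mul_sum, Finset.sum_mul]
  congr 1
  refine Finset.sum_congr rfl fun i _ => ?_
  rw [← mul_assoc, x_mul_coeffHom, mul_assoc]
  by_cases hij : i = j
  · subst hij
    rw [if_pos rfl, cdiag_self, mul_one, sub_self, zero_add, shInv_eDivB_coeff_self, ← x_mul_d_self]
    simp only [Γ, mul_assoc]
  · rw [if_neg hij, add_zero, B.x_mul_Γ s hij, ← mul_assoc, ← mul_assoc, ← map_mul,
      B.eDivB_coeff_exchange hij, map_sub, sub_mul]

theorem c_coeff_mul_d
    (hρ : ρ.coeff m - B.shInv j (ρ.coeff m) = (B.eDivB j).coeff m * s j) :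
    (B.c s ρ).coeff m * B.d s j = B.d s j * (B.c s ρ).coeff m := by
  conv_rhs => rw [← B.sum_exchange hρ]
  rw [c_coeff, mul_sub, sub_mul, coeffHom_mul_d, Finset.mul_sum, Finset.sum_mul]
  congr 1
  refine Finset.sum_congr rfl fun i _ => ?_
  by_cases hij : i = j
  · subst hij
    rw [if_pos rfl, cdiag_self, mul_one, sub_self, zero_add, ← x_mul_d_self, ← mul_assoc,
      d_mul_coeffHom, Γ]
    -- The coefficient does not involve `h̃_i`; writing it as its own translate lets the translation
    -- coming from `∂̄_i` cancel.
    rw [← B.shInv_eDivB_coeff_self i m, show B.sh i (B.shInv i ((B.eDivB i).coeff m)) =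
      (B.eDivB i).coeff m from Subtype.ext ((shift K i).apply_symm_apply _),
      B.shInv_eDivB_coeff_self i m]
    simp only [mul_assoc]
  · rw [if_neg hij, add_zero, mul_assoc, B.Γ_mul_d s hij, ← mul_assoc, coeffHom_mul_d, mul_assoc,
      ← mul_assoc (B.coeffHom s _), ← map_mul, B.eDivB_coeff_exchange hij, map_sub, sub_mul]

theorem coeffHom_mul_c_coeff (b : B.carrier) :
    B.coeffHom s b * (B.c s ρ).coeff m = (B.c s ρ).coeff m * B.coeffHom s b := by
  rw [c_coeff, mul_sub, sub_mul, Finset.mul_sum, Finset.sum_mul, ← map_mul, ← map_mul, mul_comm b]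
  congr 1
  refine Finset.sum_congr rfl fun i _ => ?_
  rw [mul_assoc, ← coeffHom_mul_Γ, ← mul_assoc, ← mul_assoc, ← map_mul, ← map_mul, mul_comm b]

end

/-- An element that commutes with the generators is central. -/
theorem mem_center_of_comm_generators {z : B.Diff s}
    (hb : ∀ b, B.coeffHom s b * z = z * B.coeffHom s b)
    (hx : ∀ j, B.x s j * z = z * B.x s j) (hd : ∀ j, B.d s j * z = z * B.d s j) :
    z ∈ Set.center (B.Diff s) := by
  rw [Semigroup.mem_center_iff]
  intro y
  obtain ⟨a, rfl⟩ := RingQuot.mkAlgHom_surjective K (B.Rel s) y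
  induction a using FreeAlgebra.induction with
  | grade0 r =>
    rw [AlgHom.commutes]
    exact Algebra.commutes r z
  | grade1 g =>
    cases g with
    | coeff b => exact hb b
    | x j => exact hx j
    | d j => exact hd j
  | mul a b ha hb => rw [map_mul, mul_assoc, hb, ← mul_assoc, ha, mul_assoc]
  | add a b ha hb => rw [map_add, add_mul, mul_add, ha, hb]

theorem central_of_solves {σ : RatH K n} (hs : ∀ j, (s j : RatH K n) = Δ K j σ)
    {ρ : B.carrier[X]} (hρ : Solves K n σ (ρ.map (algebraMap B.carrier (RatH K n)))) (m : ℕ) :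
    (B.c s ρ).coeff m ∈ Set.center (B.Diff s) := by
  have h1 : ∀ j, ρ.coeff m - B.shInv j (ρ.coeff m) = (B.eDivB j).coeff m * s j := by
    intro j
    apply Subtype.ext
    have h2 := congrArg (fun p => p.coeff m) (hρ j)
    simp only [Δt_coeff, coeff_mul_C, coeff_map] at h2
    rw [AddSubgroupClass.coe_sub, MulMemClass.coe_mul, coe_eDivB_coeff, hs]
    exact h2
  exact B.mem_center_of_comm_generators s (fun b => B.coeffHom_mul_c_coeff b)
    (fun j => B.x_mul_c_coeff (h1 j)) fun j => (B.c_coeff_mul_d (h1 j)).symm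

end CoeffRing

/-! ### Uniqueness modulo `K[t]` and the general solution. -/

theorem Solves.exists_sub_eq_map [CharZero K] {σ : RatH K n} {ρ ρ' : (RatH K n)[X]}
    (hρ : Solves K n σ ρ) (hρ' : Solves K n σ ρ') :
    ∃ p : K[X], ρ - ρ' = p.map (algebraMap K (RatH K n)) := by
  have h1 : ρ - ρ' ∈ Polynomial.lifts (algebraMap K (RatH K n)) := by
    rw [Polynomial.lifts_iff_coeff_lifts]
    intro m
    have h2 : ∀ j, shift K j ((ρ - ρ').coeff m) = (ρ - ρ').coeff m := by
      intro j
      have h3 : Δt K j (ρ - ρ') = 0 := by rw [Δt_sub, hρ j, hρ' j, sub_self]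
      have h4 := congrArg (fun p => p.coeff m) h3
      simp only [Δt_coeff, coeff_zero, Δ] at h4
      exact ((AlgEquiv.symm_apply_eq _).1 (sub_eq_zero.1 h4).symm).symm
    -- Each coefficient of the difference is annihilated by every `Δ_j`, hence invariant and
    -- constant.
    obtain ⟨a, ha⟩ := exists_eq_algebraMap_of_shift_fixed h2
    exact ⟨a, ha.symm⟩
  obtain ⟨p, hp⟩ := (Polynomial.mem_lifts _).1 h1
  exact ⟨p, hp.symm⟩

theorem solves_of_eq_sum {σ : RatH K n} {π : Fin n → K[X]}
    (hσ : σ = ∑ k, aeval (h K k) (π k) / χ K k) :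
    Solves K n σ (∑ k, eDiv K k * C (aeval (h K k) (π k) / χ K k)) := by
  rw [hσ]
  exact (isWeightFamily_div_χ _ fun k j hkj => aeval_h_shift_symm hkj (π k)).solves

end HDiff

end

theorem mainTheorem7 (K : Type*) [Field K] [IsAlgClosed K] [CharZero K] (n : ℕ) :
    -- (i), over every admissible ring of coefficients `B` that contains the `Δ_j σ`
    (∀ (B : HDiff.CoeffRing K n) (σ : HDiff.RatH K n) (s : Fin n → B.carrier)
        (ρ : Polynomial B.carrier),
        σ ∈ HDiff.Wbar K n → (∀ j, (s j : HDiff.RatH K n) = HDiff.Δ K j σ) → ρ.degree < n →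
        ((∀ k : Fin n, (B.c s ρ).coeff k ∈ Set.center (B.Diff s)) ↔
          HDiff.Solves K n σ (ρ.map (algebraMap B.carrier (HDiff.RatH K n))))) ∧
    -- (ii)
    (∀ σ ∈ HDiff.W K n,
        -- existence, with coefficients in `Ū(n)`
        (∃ ρ : Polynomial (HDiff.RatH K n), ρ.degree < n ∧ (∀ m, ρ.coeff m ∈ HDiff.Ubar K n) ∧
          HDiff.Solves K n σ ρ) ∧
        -- uniqueness modulo `K[t]`
        (∀ ρ ρ' : Polynomial (HDiff.RatH K n), HDiff.Solves K n σ ρ → HDiff.Solves K n σ ρ' →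
          ∃ p : Polynomial K, ρ - ρ' = p.map (algebraMap K (HDiff.RatH K n))) ∧
        -- the form of the solutions
        (∀ π : Fin n → Polynomial K,
          σ = ∑ k, Polynomial.aeval (HDiff.h K k) (π k) / HDiff.χ K k →
          ∀ ρ : Polynomial (HDiff.RatH K n),
            (ρ.degree < n ∧ HDiff.Solves K n σ ρ) ↔
              ∃ p : Polynomial K, p.degree < n ∧
                ρ = ∑ k, HDiff.eDiv K k *
                      Polynomial.C (Polynomial.aeval (HDiff.h K k) (π k) / HDiff.χ K k) +
                    p.map (algebraMap K (HDiff.RatH K n)))) := by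
  refine ⟨fun B σ s ρ hσ hs hρ => ⟨B.solves_of_central hσ s hs hρ,
    fun hsol k => B.central_of_solves s hs hsol k⟩, fun σ hσ => ⟨?_, ?_, ?_⟩⟩
  · obtain ⟨π, hπ⟩ := HDiff.exists_polynomial_of_mem_W hσ
    refine ⟨_, HDiff.sum_eDiv_mul_C_degree_lt _, fun m => ?_, HDiff.solves_of_eq_sum hπ⟩
    rw [finsetSum_coeff]
    refine sum_mem fun k _ => ?_
    rw [coeff_mul_C]
    exact mul_mem (HDiff.eDiv_coeff_mem_Ubar k m) (HDiff.aeval_div_χ_mem_Ubar k (π k))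
  · exact fun ρ ρ' hρ hρ' => hρ.exists_sub_eq_map hρ'
  · intro π hπ ρ
    have h0 := HDiff.solves_of_eq_sum hπ
    constructor
    · rintro ⟨hdeg, hsol⟩
      obtain ⟨p, hp⟩ := hsol.exists_sub_eq_map h0
      refine ⟨p, ?_, ?_⟩
      · rw [← degree_map p (algebraMap K (HDiff.RatH K n)), ← hp]
        exact (degree_sub_le _ _).trans_lt (max_lt hdeg (HDiff.sum_eDiv_mul_C_degree_lt _))
      · rw [← hp, add_sub_cancel]
    · rintro ⟨p, hp, rfl⟩
      refine ⟨(degree_add_le _ _).trans_lt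
        (max_lt (HDiff.sum_eDiv_mul_C_degree_lt _) (degree_map_le.trans_lt hp)), fun j => ?_⟩
      rw [HDiff.Δt_add, h0 j, HDiff.Δt_map_algebraMap, add_zero]
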